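/- Let $\sigma_x,\sigma_v,\sigma_w>0$ and let $x\sim\mathcal N(0,\sigma_x^2)$, $v\sim\mathcal N(0,\sigma_v^2)$, $w\sim\mathcal N(0,\sigma_w^2)$ be independent. An encoder is a measurable function $\gamma^e:\mathbb R\to\mathbb R$ whose message $m=\gamma^e(x)$ has finite power $P=\mathbf E[m^2]$. A decoder consists of a combining parameter $\alpha\in[0,1]$ and a measurable function $\gamma^d:\mathbb R\to\mathbb R$; it receives $$r=\alpha\,(m+v)+(1-\alpha)\,(x+w)$$ and forms the estimate $\hat x=\gamma^d(r)$. Then, for every encoder and every decoder, $$\mathbf E[(x-\hat x)^2]\;\ge\;\frac{\sigma_x^2}{\frac{P}{\sigma_v^2}+\frac{\sigma_x^2}{\sigma_w^2}+1}$$ (the left-hand side may be $+\infty$). Moreover, equality holds if and only if the encoder and the decoder jointly use matched linear strategies, that is, if and only if there is a real number $A\ge 0$ such that, almost surely, $m=Ax$ and $\hat x=K r$, where $$\alpha=\frac{A\sigma_w^2}{A\sigma_w^2+\sigma_v^2},\qquad K=\frac{A\sigma_x^2\sigma_w^2+\sigma_x^2\sigma_v^2}{A^2\sigma_x^2\sigma_w^2+\sigma_x^2\sigma_v^2+\sigma_w^2\sigma_v^2}.$$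 -/

import Mathlib

open MeasureTheory ProbabilityTheory
open scoped NNReal ENNReal

noncomputable section

/-- The decoder's input `r = α y + (1 - α) z`, where `y = m + v` is the noisy version of the
message `m = γe(x)` and `z = x + w` is the noisy side observation of the source. -/
def decoderInput {Ω : Type*} (x v w : Ω → ℝ) (γe : ℝ → ℝ) (α : ℝ) : Ω → ℝ :=
  fun ω => α * (γe (x ω) + v ω) + (1 - α) * (x ω + w ω)

/-- The power `E[m²]` of the transmitted message `m = γe(x)`. -/
def messagePower {Ω : Type*} [MeasurableSpace Ω] (μ : Measure Ω) (x : Ω → ℝ)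
    (γe : ℝ → ℝ) : ℝ :=
  ∫ ω, (γe (x ω)) ^ 2 ∂μ

/-- The mean-square estimation error `E[(x - x̂)²]` with `x̂ = γd(r)`, as an extended nonnegative
real: it is `∞` exactly when the error is not square integrable. -/
def estimationError {Ω : Type*} [MeasurableSpace Ω] (μ : Measure Ω) (x v w : Ω → ℝ)
    (γe : ℝ → ℝ) (α : ℝ) (γd : ℝ → ℝ) : ℝ≥0∞ :=
  ∫⁻ ω, ENNReal.ofReal ((x ω - γd (decoderInput x v w γe α ω)) ^ 2) ∂μ

/-- The optimal combining parameter for the linear encoder `m = A x` with `A ≥ 0`. -/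
def optimalCombining (σv σw A : ℝ) : ℝ :=
  A * σw ^ 2 / (A * σw ^ 2 + σv ^ 2)

/-- The optimal gain of the linear decoder `x̂ = K r` for the linear encoder `m = A x`
with `A ≥ 0`. -/
def optimalGain (σx σv σw A : ℝ) : ℝ :=
  (A * σx ^ 2 * σw ^ 2 + σx ^ 2 * σv ^ 2) /
    (A ^ 2 * σx ^ 2 * σw ^ 2 + σx ^ 2 * σv ^ 2 + σw ^ 2 * σv ^ 2)

end

/-!
The decoder input is `r = f(x) + n` with `f(t) = α γe(t) + (1 - α) t` and the independent Gaussian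
noise `n = α v + (1 - α) w` of variance `b`: a scalar additive Gaussian channel used at power
`Q = E[f(x)²]`.

For such a channel and a source of variance `a`, every decoder has error `D ≥ a / (Q / b + 1)`.
Compare the joint density of `(x, n)` with that of the backward channel, in which
`r ∼ N(0, Q + b)` and `x` given `r` is Gaussian around the reconstruction with variance
`s = a / (Q / b + 1)`. The expectation of the ratio of the two densities is `1`, so the
expectation of its logarithm, which equals `(1 - D / s) / 2`, is at most `0`.

By Cauchy–Schwarz, in the form of Lagrange's identity, the signal-to-noise ratio `Q / b` is at most
`P / σv² + σx² / σw²`, with equality iff `α σv² x = (1 - α) σw² m`, that is, iff the encoder is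
linear and matched to `α`. For a linear encoder, the residual of the linear least-squares estimator
is independent of `r`, so Pythagoras shows that this estimator is the only optimal decoder.
-/

section Moments

variable {Ω : Type*} [MeasurableSpace Ω] {μ : Measure Ω} {X Y : Ω → ℝ}

lemma integral_eq_of_hasLaw_gaussianReal {m : ℝ} {a : ℝ≥0} (hX : HasLaw X (gaussianReal m a) μ) :
    ∫ ω, X ω ∂μ = m := by
  rw [hX.integral_eq, integral_id_gaussianReal]

lemma integral_sq_of_hasLaw_gaussianReal {a : ℝ≥0} (hX : HasLaw X (gaussianReal 0 a) μ) :
    ∫ ω, X ω ^ 2 ∂μ = a := by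
  rw [← variance_of_integral_eq_zero hX.aemeasurable (integral_eq_of_hasLaw_gaussianReal hX),
    hX.variance_eq, variance_id_gaussianReal]

lemma memLp_two_of_lintegral_ofReal_sq_ne_top (hX : AEStronglyMeasurable X μ)
    (h : ∫⁻ ω, ENNReal.ofReal (X ω ^ 2) ∂μ ≠ ∞) : MemLp X 2 μ :=
  (memLp_two_iff_integrable_sq hX).2 <|
    (lintegral_ofReal_ne_top_iff_integrable (hX.pow 2) (ae_of_all _ fun _ ↦ sq_nonneg _)).1 h

lemma lintegral_ofReal_sq_eq_ofReal_integral_sq (hX : MemLp X 2 μ) :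
    ∫⁻ ω, ENNReal.ofReal (X ω ^ 2) ∂μ = ENNReal.ofReal (∫ ω, X ω ^ 2 ∂μ) :=
  (ofReal_integral_eq_lintegral_ofReal hX.integrable_sq (ae_of_all _ fun _ ↦ sq_nonneg _)).symm

lemma integral_sq_eq_zero_iff (hX : MemLp X 2 μ) :
    ∫ ω, X ω ^ 2 ∂μ = 0 ↔ ∀ᵐ ω ∂μ, X ω = 0 := by
  rw [integral_eq_zero_iff_of_nonneg (fun ω ↦ sq_nonneg (X ω)) hX.integrable_sq]
  exact Filter.eventually_congr (ae_of_all _ fun ω ↦ pow_eq_zero_iff two_ne_zero)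

lemma not_ae_eq_zero_of_hasLaw_gaussianReal {a : ℝ≥0} (ha : a ≠ 0)
    (hX : HasLaw X (gaussianReal 0 a) μ) : ¬ ∀ᵐ ω ∂μ, X ω = 0 := by
  rwa [← integral_sq_eq_zero_iff hX.hasGaussianLaw.memLp_two,
    integral_sq_of_hasLaw_gaussianReal hX, NNReal.coe_eq_zero]

lemma integral_sq_add_of_indepFun (hX : MemLp X 2 μ) (hY : MemLp Y 2 μ) (hXY : IndepFun X Y μ)
    (hX0 : ∫ ω, X ω ∂μ = 0) :
    ∫ ω, (X ω + Y ω) ^ 2 ∂μ = ∫ ω, X ω ^ 2 ∂μ + ∫ ω, Y ω ^ 2 ∂μ := by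
  have hXYint : Integrable (fun ω ↦ X ω * Y ω) μ := hX.integrable_mul hY
  have hcross : ∫ ω, X ω * Y ω ∂μ = 0 := by
    rw [hXY.integral_fun_mul_eq_mul_integral hX.aestronglyMeasurable hY.aestronglyMeasurable, hX0,
      zero_mul]
  calc ∫ ω, (X ω + Y ω) ^ 2 ∂μ
      = ∫ ω, (X ω ^ 2 + Y ω ^ 2 + 2 * (X ω * Y ω)) ∂μ := by congr 1 with ω; ring
    _ = ∫ ω, X ω ^ 2 ∂μ + ∫ ω, Y ω ^ 2 ∂μ := by
      rw [integral_add (hX.integrable_sq.fun_add hY.integrable_sq) (hXYint.const_mul 2),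
        integral_add hX.integrable_sq hY.integrable_sq, integral_const_mul, hcross, mul_zero,
        add_zero]

lemma integral_nonpos_of_lintegral_exp_le_one [IsProbabilityMeasure μ] (hX : Integrable X μ)
    (h : ∫⁻ ω, ENNReal.ofReal (Real.exp (X ω)) ∂μ ≤ 1) : ∫ ω, X ω ∂μ ≤ 0 := by
  have hexp_nonneg : 0 ≤ᵐ[μ] fun ω ↦ Real.exp (X ω) := ae_of_all _ fun ω ↦ (Real.exp_pos _).le
  have hexp_meas := Real.continuous_exp.comp_aestronglyMeasurable hX.aestronglyMeasurable
  have hexp_int : Integrable (fun ω ↦ Real.exp (X ω)) μ :=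
    (lintegral_ofReal_ne_top_iff_integrable hexp_meas hexp_nonneg).1
      (h.trans_lt ENNReal.one_lt_top).ne
  have hle : ∫ ω, X ω ∂μ + 1 ≤ 1 := calc
    ∫ ω, X ω ∂μ + 1 = ∫ ω, (X ω + 1) ∂μ := by simp [integral_add hX (integrable_const 1)]
    _ ≤ ∫ ω, Real.exp (X ω) ∂μ :=
      integral_mono (hX.add (integrable_const 1)) hexp_int fun ω ↦ Real.add_one_le_exp _
    _ ≤ 1 := by
      rw [integral_eq_lintegral_of_nonneg_ae hexp_nonneg hexp_meas]
      exact ENNReal.toReal_le_of_le_ofReal zero_le_one (by simpa using h)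
  linarith

end Moments

section IndependentGaussians

variable {Ω : Type*} [MeasurableSpace Ω] {μ : Measure Ω} {X N : Ω → ℝ} {a b : ℝ≥0}

lemma hasLaw_linear_combination_gaussianReal {m n : ℝ} (hX : HasLaw X (gaussianReal m a) μ)
    (hN : HasLaw N (gaussianReal n b) μ) (hXN : IndepFun X N μ) (p q : ℝ) :
    HasLaw (fun ω ↦ p * X ω + q * N ω)
      (gaussianReal (p * m + q * n) (‖p‖₊ ^ 2 * a + ‖q‖₊ ^ 2 * b)) μ := by
  have hpX := gaussianReal_const_mul hX p
  have hqN := gaussianReal_const_mul hN q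
  have hsq (t : ℝ) : (.mk (t ^ 2) (sq_nonneg t) : ℝ≥0) = ‖t‖₊ ^ 2 := by ext; simp
  rw [hsq] at hpX hqN
  exact ⟨hpX.aemeasurable.add hqN.aemeasurable, gaussianReal_add_gaussianReal_of_indepFun
    (hXN.comp (measurable_const_mul p) (measurable_const_mul q)) hpX.map_eq hqN.map_eq⟩

lemma integral_sq_linear_combination_gaussian (hX : HasLaw X (gaussianReal 0 a) μ)
    (hN : HasLaw N (gaussianReal 0 b) μ) (hXN : IndepFun X N μ) (p q : ℝ) :
    ∫ ω, (p * X ω + q * N ω) ^ 2 ∂μ = p ^ 2 * a + q ^ 2 * b := by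
  have hlaw := hasLaw_linear_combination_gaussianReal hX hN hXN p q
  simp only [mul_zero, add_zero] at hlaw
  simp [integral_sq_of_hasLaw_gaussianReal hlaw]

lemma covariance_linear_combination_of_indepFun [IsFiniteMeasure μ] (hX : MemLp X 2 μ)
    (hN : MemLp N 2 μ) (hXN : IndepFun X N μ) (p q p' q' : ℝ) :
    cov[fun ω ↦ p * X ω + q * N ω, fun ω ↦ p' * X ω + q' * N ω; μ] =
      p * p' * Var[X; μ] + q * q' * Var[N; μ] := by
  have hp (c : ℝ) : MemLp (fun ω ↦ c * X ω) 2 μ := hX.const_mul c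
  have hq (c : ℝ) : MemLp (fun ω ↦ c * N ω) 2 μ := hN.const_mul c
  change cov[(fun ω ↦ p * X ω) + fun ω ↦ q * N ω, (fun ω ↦ p' * X ω) + fun ω ↦ q' * N ω; μ] = _
  rw [covariance_add_left (hp p) (hq q) ((hp p').add (hq q')),
    covariance_add_right (hp p) (hp p') (hq q'), covariance_add_right (hq q) (hp p') (hq q')]
  simp only [covariance_const_mul_left, covariance_const_mul_right, covariance_comm N X,
    hXN.covariance_eq_zero hX hN, covariance_self hX.aemeasurable, covariance_self hN.aemeasurable]
  ring

lemma indepFun_linear_combination_gaussian {m n : ℝ} (hX : HasLaw X (gaussianReal m a) μ)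
    (hN : HasLaw N (gaussianReal n b) μ) (hXN : IndepFun X N μ) {p q p' q' : ℝ}
    (h : p * p' * a + q * q' * b = 0) :
    IndepFun (fun ω ↦ p * X ω + q * N ω) (fun ω ↦ p' * X ω + q' * N ω) μ := by
  have := hX.isProbabilityMeasure
  have hjoint : HasGaussianLaw (fun ω ↦ (X ω, N ω)) μ :=
    hXN.hasGaussianLaw hX.hasGaussianLaw hN.hasGaussianLaw
  let fst := ContinuousLinearMap.fst ℝ ℝ ℝ
  let snd := ContinuousLinearMap.snd ℝ ℝ ℝ
  refine HasGaussianLaw.indepFun_of_covariance_eq_zero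
    (hjoint.map_fun ((p • fst + q • snd).prod (p' • fst + q' • snd))) ?_
  rw [covariance_linear_combination_of_indepFun hX.hasGaussianLaw.memLp_two
    hN.hasGaussianLaw.memLp_two hXN, hX.variance_eq, hN.variance_eq,
    variance_id_gaussianReal, variance_id_gaussianReal, h]

end IndependentGaussians

section BackwardChannel

/-- The log-likelihood ratio of a backward channel against a forward one, for the source value `x`,
the noise `n`, the channel output `r` and the reconstruction `y`. Forward, `x ∼ N(0, a)` and
`n ∼ N(0, b)` are independent; backward, `r ∼ N(0, c)` and `x ∼ N(y, s)` given `r`. The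
normalizing constants are left out: they cancel when `a * b = s * c`. -/
noncomputable def backwardLogRatio (a b c s : ℝ≥0) (x n r y : ℝ) : ℝ :=
  x ^ 2 / (2 * a) + n ^ 2 / (2 * b) - ((x - y) ^ 2 / (2 * s) + r ^ 2 / (2 * c))

variable {a b c s : ℝ≥0}

@[fun_prop]
lemma measurable_backwardLogRatio {α : Type*} [MeasurableSpace α] {x n r y : α → ℝ}
    (hx : Measurable x) (hn : Measurable n) (hr : Measurable r) (hy : Measurable y) :
    Measurable fun t ↦ backwardLogRatio a b c s (x t) (n t) (r t) (y t) := by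
  unfold backwardLogRatio
  fun_prop

lemma gaussianPDFReal_mul_gaussianPDFReal (m₁ m₂ : ℝ) (v₁ v₂ : ℝ≥0) (x₁ x₂ : ℝ) :
    gaussianPDFReal m₁ v₁ x₁ * gaussianPDFReal m₂ v₂ x₂ =
      (2 * Real.pi * √(v₁ * v₂ : ℝ≥0))⁻¹ *
        Real.exp (-(x₁ - m₁) ^ 2 / (2 * v₁) + -(x₂ - m₂) ^ 2 / (2 * v₂)) := by
  have hsqrt : √(2 * Real.pi * v₁) * √(2 * Real.pi * v₂) = 2 * Real.pi * √(v₁ * v₂ : ℝ≥0) := by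
    rw [← Real.sqrt_mul (by positivity), show 2 * Real.pi * v₁ * (2 * Real.pi * v₂) =
      (2 * Real.pi) ^ 2 * (v₁ * v₂ : ℝ≥0) by push_cast; ring, Real.sqrt_mul (by positivity),
      Real.sqrt_sq (by positivity)]
  rw [gaussianPDFReal, gaussianPDFReal, Real.exp_add, ← hsqrt, mul_inv]
  ring

lemma gaussianPDF_mul_exp_backwardLogRatio (h : a * b = s * c) (x n r y : ℝ) :
    gaussianPDF 0 a x * (gaussianPDF 0 b n *
      ENNReal.ofReal (Real.exp (backwardLogRatio a b c s x n r y))) =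
    gaussianPDF y s x * gaussianPDF 0 c r := by
  simp only [gaussianPDF]
  rw [← mul_assoc, ← ENNReal.ofReal_mul (gaussianPDFReal_nonneg _ _ _),
    ← ENNReal.ofReal_mul (gaussianPDFReal_nonneg _ _ _),
    ← ENNReal.ofReal_mul (mul_nonneg (gaussianPDFReal_nonneg _ _ _) (gaussianPDFReal_nonneg _ _ _)),
    gaussianPDFReal_mul_gaussianPDFReal, gaussianPDFReal_mul_gaussianPDFReal, h, mul_assoc,
    ← Real.exp_add, backwardLogRatio]
  ring_nf

lemma lintegral_gaussianReal {m : ℝ} {v : ℝ≥0} (hv : v ≠ 0) {F : ℝ → ℝ≥0∞} (hF : Measurable F) :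
    ∫⁻ x, F x ∂(gaussianReal m v) = ∫⁻ x, gaussianPDF m v x * F x := by
  rw [gaussianReal_of_var_ne_zero _ hv,
    lintegral_withDensity_eq_lintegral_mul _ (measurable_gaussianPDF _ _) hF]
  rfl

lemma lintegral_lintegral_gaussianPDF_mul_gaussianPDF (hs : s ≠ 0) (hc : c ≠ 0) {g : ℝ → ℝ}
    (hg : Measurable g) :
    ∫⁻ x, ∫⁻ r, gaussianPDF (g r) s x * gaussianPDF 0 c r = 1 := by
  have hmeas : Measurable fun p : ℝ × ℝ ↦ gaussianPDF (g p.2) s p.1 * gaussianPDF 0 c p.2 := by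
    have hpdf := measurable_uncurry_gaussianPDF
    exact (hpdf.comp (f := fun p : ℝ × ℝ ↦ (g p.2, s, p.1)) (by fun_prop)).mul
      (hpdf.comp (f := fun p : ℝ × ℝ ↦ ((0 : ℝ), c, p.2)) (by fun_prop))
  rw [lintegral_lintegral_swap hmeas.aemeasurable]
  simp_rw [lintegral_mul_const' _ _ gaussianPDF_ne_top, lintegral_gaussianPDF_eq_one _ hs, one_mul]
  exact lintegral_gaussianPDF_eq_one _ hc

lemma lintegral_exp_backwardLogRatio_eq_one (ha : a ≠ 0) (hb : b ≠ 0) (hc : c ≠ 0) (hs : s ≠ 0)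
    (h : a * b = s * c) {f g : ℝ → ℝ} (hf : Measurable f) (hg : Measurable g) :
    ∫⁻ p : ℝ × ℝ, ENNReal.ofReal
      (Real.exp (backwardLogRatio a b c s p.1 p.2 (f p.1 + p.2) (g (f p.1 + p.2))))
      ∂((gaussianReal 0 a).prod (gaussianReal 0 b)) = 1 := by
  set L : ℝ × ℝ → ℝ≥0∞ := fun p ↦ ENNReal.ofReal
    (Real.exp (backwardLogRatio a b c s p.1 p.2 (f p.1 + p.2) (g (f p.1 + p.2)))) with hL
  have hLmeas : Measurable L := by fun_prop
  have hchannel (x : ℝ) : gaussianPDF 0 a x * ∫⁻ n, L (x, n) ∂(gaussianReal 0 b) =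
      ∫⁻ r, gaussianPDF (g r) s x * gaussianPDF 0 c r := by
    rw [lintegral_gaussianReal hb (by fun_prop), ← lintegral_const_mul' _ _ gaussianPDF_ne_top]
    simp only [hL, gaussianPDF_mul_exp_backwardLogRatio h]
    exact lintegral_add_left_eq_self (fun r ↦ gaussianPDF (g r) s x * gaussianPDF 0 c r) (f x)
  rw [lintegral_prod _ hLmeas.aemeasurable,
    lintegral_gaussianReal ha hLmeas.lintegral_prod_right']
  simp only [hchannel]
  exact lintegral_lintegral_gaussianPDF_mul_gaussianPDF hs hc hg

variable {Ω : Type*} [MeasurableSpace Ω] {μ : Measure Ω} {X N R Y : Ω → ℝ}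

lemma integrable_backwardLogRatio (hX : MemLp X 2 μ) (hN : MemLp N 2 μ) (hR : MemLp R 2 μ)
    (hXY : MemLp (fun ω ↦ X ω - Y ω) 2 μ) :
    Integrable (fun ω ↦ backwardLogRatio a b c s (X ω) (N ω) (R ω) (Y ω)) μ :=
  ((hX.integrable_sq.div_const _).add (hN.integrable_sq.div_const _)).sub
    ((hXY.integrable_sq.div_const _).add (hR.integrable_sq.div_const _))

lemma integral_backwardLogRatio (hX : MemLp X 2 μ) (hN : MemLp N 2 μ) (hR : MemLp R 2 μ)
    (hXY : MemLp (fun ω ↦ X ω - Y ω) 2 μ) :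
    ∫ ω, backwardLogRatio a b c s (X ω) (N ω) (R ω) (Y ω) ∂μ =
      (∫ ω, X ω ^ 2 ∂μ) / (2 * a) + (∫ ω, N ω ^ 2 ∂μ) / (2 * b)
        - ((∫ ω, (X ω - Y ω) ^ 2 ∂μ) / (2 * s) + (∫ ω, R ω ^ 2 ∂μ) / (2 * c)) := by
  have hX' := hX.integrable_sq.div_const (2 * a : ℝ)
  have hN' := hN.integrable_sq.div_const (2 * b : ℝ)
  have hXY' := hXY.integrable_sq.div_const (2 * s : ℝ)
  have hR' := hR.integrable_sq.div_const (2 * c : ℝ)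
  simp only [backwardLogRatio, ← integral_div]
  rw [integral_sub (hX'.fun_add hN') (hXY'.fun_add hR'), integral_add hX' hN',
    integral_add hXY' hR']

end BackwardChannel

section GaussianChannel

/-- The mean-square error `E[(X - g(r))²]` of estimating the source `X` from the output
`r = f(X) + N` of the channel with additive noise `N`, for the encoder `f` and the decoder `g`. -/
noncomputable def channelError {Ω : Type*} [MeasurableSpace Ω] (μ : Measure Ω) (X N : Ω → ℝ)
    (f g : ℝ → ℝ) : ℝ≥0∞ :=
  ∫⁻ ω, ENNReal.ofReal ((X ω - g (f (X ω) + N ω)) ^ 2) ∂μ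

/-- The gain `K` of the linear least-squares estimator `K r` of `X` from `r = β X + N`, where `X`
and `N` are independent and centered with variances `a` and `b`. -/
noncomputable def leastSquaresGain (a b β : ℝ) : ℝ :=
  β * a / (β ^ 2 * a + b)

variable {Ω : Type*} [MeasurableSpace Ω] {μ : Measure Ω} {X N : Ω → ℝ} {a b : ℝ≥0} {f g : ℝ → ℝ}

lemma messagePower_nonneg : 0 ≤ messagePower μ X f :=
  integral_nonneg fun _ ↦ sq_nonneg _

lemma memLp_two_of_channelError_ne_top (hX : AEMeasurable X μ) (hN : AEMeasurable N μ)
    (hf : Measurable f) (hg : Measurable g) (h : channelError μ X N f g ≠ ∞) :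
    MemLp (fun ω ↦ X ω - g (f (X ω) + N ω)) 2 μ :=
  memLp_two_of_lintegral_ofReal_sq_ne_top (by fun_prop : AEMeasurable _ μ).aestronglyMeasurable h

lemma integral_sq_channel_output (hN : HasLaw N (gaussianReal 0 b) μ) (hXN : IndepFun X N μ)
    (hf : Measurable f) (hfX : MemLp (fun ω ↦ f (X ω)) 2 μ) :
    ∫ ω, (f (X ω) + N ω) ^ 2 ∂μ = messagePower μ X f + b := by
  simp only [add_comm (f _)]
  rw [integral_sq_add_of_indepFun hN.hasGaussianLaw.memLp_two hfX
    (hXN.symm.comp measurable_id hf) (integral_eq_of_hasLaw_gaussianReal hN),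
    integral_sq_of_hasLaw_gaussianReal hN, messagePower, add_comm]

lemma le_integral_sq_channel_error (ha : a ≠ 0) (hb : b ≠ 0) (hX : HasLaw X (gaussianReal 0 a) μ)
    (hN : HasLaw N (gaussianReal 0 b) μ) (hXN : IndepFun X N μ) (hf : Measurable f)
    (hg : Measurable g) (hfX : MemLp (fun ω ↦ f (X ω)) 2 μ)
    (herr : MemLp (fun ω ↦ X ω - g (f (X ω) + N ω)) 2 μ) :
    a / (messagePower μ X f / b + 1) ≤ ∫ ω, (X ω - g (f (X ω) + N ω)) ^ 2 ∂μ := by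
  have := hX.isProbabilityMeasure
  obtain ⟨Q, hQ⟩ : ∃ Q : ℝ≥0, (Q : ℝ) = messagePower μ X f := ⟨⟨_, messagePower_nonneg⟩, rfl⟩
  set c : ℝ≥0 := Q + b with hc
  set s : ℝ≥0 := a / (Q / b + 1) with hs
  have hc0 : c ≠ 0 := by positivity
  have hs0 : s ≠ 0 := by positivity
  have hratio : a * b = s * c := by rw [hs, hc]; field_simp
  have hXL := hX.hasGaussianLaw.memLp_two
  have hNL := hN.hasGaussianLaw.memLp_two
  have hRL : MemLp (fun ω ↦ f (X ω) + N ω) 2 μ := hfX.add hNL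
  set D := ∫ ω, (X ω - g (f (X ω) + N ω)) ^ 2 ∂μ with hD
  have hexp : ∫⁻ ω, ENNReal.ofReal (Real.exp (backwardLogRatio a b c s (X ω) (N ω)
      (f (X ω) + N ω) (g (f (X ω) + N ω)))) ∂μ = 1 := by
    rw [← lintegral_exp_backwardLogRatio_eq_one ha hb hc0 hs0 hratio hf hg,
      ← ((indepFun_iff_hasLaw_prodMk_prod hX hN).1 hXN).lintegral_comp (by fun_prop)]
  have hmean : ∫ ω, backwardLogRatio a b c s (X ω) (N ω) (f (X ω) + N ω) (g (f (X ω) + N ω)) ∂μ =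
      (1 - D / s) / 2 := by
    have hR : ∫ ω, (f (X ω) + N ω) ^ 2 ∂μ = c := by
      rw [integral_sq_channel_output hN hXN hf hfX, hc, NNReal.coe_add, hQ]
    rw [integral_backwardLogRatio hXL hNL hRL herr, hR, integral_sq_of_hasLaw_gaussianReal hX,
      integral_sq_of_hasLaw_gaussianReal hN, ← hD]
    field_simp
    ring
  have hnonpos := integral_nonpos_of_lintegral_exp_le_one
    (integrable_backwardLogRatio hXL hNL hRL herr) hexp.le
  have hsD : (s : ℝ) ≤ D := (one_le_div (by positivity)).1 (by linarith)
  simpa [hs, hQ] using hsD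

theorem le_channelError (ha : a ≠ 0) (hb : b ≠ 0) (hX : HasLaw X (gaussianReal 0 a) μ)
    (hN : HasLaw N (gaussianReal 0 b) μ) (hXN : IndepFun X N μ) (hf : Measurable f)
    (hg : Measurable g) (hfX : MemLp (fun ω ↦ f (X ω)) 2 μ) :
    ENNReal.ofReal (a / (messagePower μ X f / b + 1)) ≤ channelError μ X N f g := by
  by_cases htop : channelError μ X N f g = ∞
  · exact htop ▸ le_top
  have herr := memLp_two_of_channelError_ne_top hX.aemeasurable hN.aemeasurable hf hg htop
  rw [channelError, lintegral_ofReal_sq_eq_ofReal_integral_sq herr]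
  exact ENNReal.ofReal_le_ofReal (le_integral_sq_channel_error ha hb hX hN hXN hf hg hfX herr)

section LinearEncoder

lemma indepFun_sub_leastSquares (hb : b ≠ 0) (hX : HasLaw X (gaussianReal 0 a) μ)
    (hN : HasLaw N (gaussianReal 0 b) μ) (hXN : IndepFun X N μ) (β : ℝ) :
    IndepFun (fun ω ↦ X ω - leastSquaresGain a b β * (β * X ω + N ω))
      (fun ω ↦ β * X ω + N ω) μ := by
  set K := leastSquaresGain a b β with hK
  have hcov : (1 - K * β) * β * a + -K * 1 * b = 0 := by
    rw [hK, leastSquaresGain]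
    field_simp
    ring
  convert indepFun_linear_combination_gaussian hX hN hXN hcov using 2 <;> ring

lemma integral_sq_sub_leastSquares (hb : b ≠ 0) (hX : HasLaw X (gaussianReal 0 a) μ)
    (hN : HasLaw N (gaussianReal 0 b) μ) (hXN : IndepFun X N μ) (β : ℝ) :
    ∫ ω, (X ω - leastSquaresGain a b β * (β * X ω + N ω)) ^ 2 ∂μ = a / (β ^ 2 * a / b + 1) := by
  set K := leastSquaresGain a b β with hK
  have hresidual (ω : Ω) : X ω - K * (β * X ω + N ω) = (1 - K * β) * X ω + -K * N ω := by ring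
  simp only [hresidual]
  rw [integral_sq_linear_combination_gaussian hX hN hXN, hK, leastSquaresGain]
  field_simp
  ring

lemma integral_sq_sub_eq_leastSquares_add (hb : b ≠ 0) (hX : HasLaw X (gaussianReal 0 a) μ)
    (hN : HasLaw N (gaussianReal 0 b) μ) (hXN : IndepFun X N μ) (hg : Measurable g) {β : ℝ}
    (hgr : MemLp (fun ω ↦ leastSquaresGain a b β * (β * X ω + N ω) - g (β * X ω + N ω)) 2 μ) :
    ∫ ω, (X ω - g (β * X ω + N ω)) ^ 2 ∂μ = a / (β ^ 2 * a / b + 1) +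
      ∫ ω, (leastSquaresGain a b β * (β * X ω + N ω) - g (β * X ω + N ω)) ^ 2 ∂μ := by
  have hind := indepFun_sub_leastSquares hb hX hN hXN β
  have hmin := integral_sq_sub_leastSquares hb hX hN hXN β
  set K := leastSquaresGain a b β
  have := hX.isProbabilityMeasure
  have hXL := hX.hasGaussianLaw.memLp_two
  have hrL : MemLp (fun ω ↦ β * X ω + N ω) 2 μ :=
    (hXL.const_mul β).add hN.hasGaussianLaw.memLp_two
  have hresidual : MemLp (fun ω ↦ X ω - K * (β * X ω + N ω)) 2 μ := hXL.sub (hrL.const_mul K)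
  have hcentered : ∫ ω, (X ω - K * (β * X ω + N ω)) ∂μ = 0 := by
    have hXi := hXL.integrable one_le_two
    have hNi := hN.hasGaussianLaw.memLp_two.integrable one_le_two
    rw [integral_sub hXi ((hrL.integrable one_le_two).const_mul K), integral_const_mul,
      integral_add (hXi.const_mul β) hNi, integral_const_mul,
      integral_eq_of_hasLaw_gaussianReal hX, integral_eq_of_hasLaw_gaussianReal hN]
    simp
  have hpythagoras := integral_sq_add_of_indepFun hresidual hgr
    (hind.comp measurable_id (by fun_prop : Measurable fun r ↦ K * r - g r)) hcentered
  simpa only [sub_add_sub_cancel, hmin] using hpythagoras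

lemma channelError_const_mul_eq_iff (hb : b ≠ 0) (hX : HasLaw X (gaussianReal 0 a) μ)
    (hN : HasLaw N (gaussianReal 0 b) μ) (hXN : IndepFun X N μ) (hg : Measurable g) (β : ℝ) :
    channelError μ X N (β * ·) g = ENNReal.ofReal (a / (β ^ 2 * a / b + 1)) ↔
      ∀ᵐ ω ∂μ, g (β * X ω + N ω) = leastSquaresGain a b β * (β * X ω + N ω) := by
  have hXL := hX.hasGaussianLaw.memLp_two
  have hrL : MemLp (fun ω ↦ β * X ω + N ω) 2 μ :=
    (hXL.const_mul β).add hN.hasGaussianLaw.memLp_two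
  have hresidual : MemLp (fun ω ↦ X ω - leastSquaresGain a b β * (β * X ω + N ω)) 2 μ :=
    hXL.sub (hrL.const_mul _)
  constructor
  · intro h
    have herr := memLp_two_of_channelError_ne_top hX.aemeasurable hN.aemeasurable
      (measurable_const_mul β) hg (h.trans_ne ENNReal.ofReal_ne_top)
    have hgr : MemLp (fun ω ↦
        leastSquaresGain a b β * (β * X ω + N ω) - g (β * X ω + N ω)) 2 μ := by
      convert! herr.sub hresidual using 1
      ext ω
      simp
    rw [channelError, lintegral_ofReal_sq_eq_ofReal_integral_sq herr, ENNReal.ofReal_eq_ofReal_iff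
      (integral_nonneg fun _ ↦ sq_nonneg _) (by positivity),
      integral_sq_sub_eq_leastSquares_add hb hX hN hXN hg hgr, add_eq_left,
      integral_sq_eq_zero_iff hgr] at h
    filter_upwards [h] with ω hω using (sub_eq_zero.1 hω).symm
  · intro h
    rw [← integral_sq_sub_leastSquares hb hX hN hXN,
      ← lintegral_ofReal_sq_eq_ofReal_integral_sq hresidual]
    refine lintegral_congr_ae ?_
    filter_upwards [h] with ω hω
    rw [hω]

theorem channelError_eq_iff_of_ae_linear (hb : b ≠ 0) (hX : HasLaw X (gaussianReal 0 a) μ)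
    (hN : HasLaw N (gaussianReal 0 b) μ) (hXN : IndepFun X N μ) (hg : Measurable g) {β : ℝ}
    (hf : ∀ᵐ ω ∂μ, f (X ω) = β * X ω) :
    channelError μ X N f g = ENNReal.ofReal (a / (messagePower μ X f / b + 1)) ↔
      ∀ᵐ ω ∂μ, g (f (X ω) + N ω) = leastSquaresGain a b β * (f (X ω) + N ω) := by
  have herr : channelError μ X N f g = channelError μ X N (β * ·) g := by
    refine lintegral_congr_ae ?_
    filter_upwards [hf] with ω hω
    rw [hω]
  have hpow : messagePower μ X f = β ^ 2 * a := by
    rw [← integral_sq_of_hasLaw_gaussianReal hX, ← integral_const_mul]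
    refine integral_congr_ae ?_
    filter_upwards [hf] with ω hω
    rw [hω, mul_pow]
  rw [herr, hpow, channelError_const_mul_eq_iff hb hX hN hXN hg]
  refine Filter.eventually_congr ?_
  filter_upwards [hf] with ω hω
  rw [hω]

end LinearEncoder

end GaussianChannel

section CauchySchwarz

variable {Ω : Type*} [MeasurableSpace Ω] {μ : Measure Ω} {U V : Ω → ℝ} {s t : ℝ}

lemma integral_lagrange_identity (hU : MemLp U 2 μ) (hV : MemLp V 2 μ) (hs : s ≠ 0) (ht : t ≠ 0)
    (p q : ℝ) :
    (p ^ 2 * s ^ 2 + q ^ 2 * t ^ 2) * ((∫ ω, U ω ^ 2 ∂μ) / s ^ 2 + (∫ ω, V ω ^ 2 ∂μ) / t ^ 2) =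
      ∫ ω, (p * U ω + q * V ω) ^ 2 ∂μ + ∫ ω, (p * s / t * V ω - q * t / s * U ω) ^ 2 ∂μ := by
  have hsum : MemLp (fun ω ↦ p * U ω + q * V ω) 2 μ := (hU.const_mul p).add (hV.const_mul q)
  have hdiff : MemLp (fun ω ↦ p * s / t * V ω - q * t / s * U ω) 2 μ :=
    (hV.const_mul _).sub (hU.const_mul _)
  rw [← integral_add hsum.integrable_sq hdiff.integrable_sq, ← integral_div, ← integral_div,
    ← integral_add (hU.integrable_sq.div_const _) (hV.integrable_sq.div_const _),
    ← integral_const_mul]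
  congr 1 with ω
  field_simp
  ring

lemma integral_sq_linear_combination_le (hU : MemLp U 2 μ) (hV : MemLp V 2 μ) (hs : s ≠ 0)
    (ht : t ≠ 0) (p q : ℝ) :
    ∫ ω, (p * U ω + q * V ω) ^ 2 ∂μ ≤
      (p ^ 2 * s ^ 2 + q ^ 2 * t ^ 2) *
        ((∫ ω, U ω ^ 2 ∂μ) / s ^ 2 + (∫ ω, V ω ^ 2 ∂μ) / t ^ 2) := by
  rw [integral_lagrange_identity hU hV hs ht]
  exact le_add_of_nonneg_right (integral_nonneg fun _ ↦ sq_nonneg _)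

lemma integral_sq_linear_combination_eq_iff (hU : MemLp U 2 μ) (hV : MemLp V 2 μ) (hs : s ≠ 0)
    (ht : t ≠ 0) (p q : ℝ) :
    ∫ ω, (p * U ω + q * V ω) ^ 2 ∂μ =
        (p ^ 2 * s ^ 2 + q ^ 2 * t ^ 2) *
          ((∫ ω, U ω ^ 2 ∂μ) / s ^ 2 + (∫ ω, V ω ^ 2 ∂μ) / t ^ 2) ↔
      ∀ᵐ ω ∂μ, p * s ^ 2 * V ω = q * t ^ 2 * U ω := by
  have hdiff : MemLp (fun ω ↦ p * s / t * V ω - q * t / s * U ω) 2 μ :=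
    (hV.const_mul _).sub (hU.const_mul _)
  rw [integral_lagrange_identity hU hV hs ht, left_eq_add, integral_sq_eq_zero_iff hdiff]
  refine Filter.eventually_congr (ae_of_all _ fun ω ↦ ?_)
  rw [sub_eq_zero]
  field_simp

end CauchySchwarz

section Combining

/-- The encoder of the scalar channel behind the decoder input: the part of `r` that depends on the
source value `t`. -/
def combinedEncoder (γe : ℝ → ℝ) (α : ℝ) : ℝ → ℝ :=
  fun t ↦ α * γe t + (1 - α) * t

/-- The noise of the scalar channel behind the decoder input: the part of `r` that does not depend
on the source. -/
def combinedNoise {Ω : Type*} (v w : Ω → ℝ) (α : ℝ) : Ω → ℝ :=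
  fun ω ↦ α * v ω + (1 - α) * w ω

/-- The variance of `combinedNoise v w α` for independent `v` and `w` with standard deviations `σv`
and `σw`. -/
noncomputable def combinedNoiseVariance (σv σw : ℝ≥0) (α : ℝ) : ℝ≥0 :=
  ‖α‖₊ ^ 2 * σv ^ 2 + ‖1 - α‖₊ ^ 2 * σw ^ 2

lemma coe_combinedNoiseVariance (σv σw : ℝ≥0) (α : ℝ) :
    (combinedNoiseVariance σv σw α : ℝ) = α ^ 2 * σv ^ 2 + (1 - α) ^ 2 * σw ^ 2 := by
  simp [combinedNoiseVariance]

lemma combinedNoiseVariance_ne_zero {σv σw : ℝ≥0} (hσv : σv ≠ 0) (hσw : σw ≠ 0) (α : ℝ) :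
    combinedNoiseVariance σv σw α ≠ 0 := by
  rcases eq_or_ne α 0 with rfl | hα
  · simpa [combinedNoiseVariance] using hσw
  · have : ‖α‖₊ ^ 2 * σv ^ 2 ≠ 0 := by simp [hα, hσv]
    exact (this.bot_lt.trans_le le_self_add).ne'

lemma one_sub_optimalCombining {σv σw A : ℝ} (h : A * σw ^ 2 + σv ^ 2 ≠ 0) :
    1 - optimalCombining σv σw A = σv ^ 2 / (A * σw ^ 2 + σv ^ 2) := by
  rw [optimalCombining]
  field_simp
  ring

lemma nonneg_iff_of_optimalCombining_mem_Icc {σv σw A : ℝ} (hσv : σv ≠ 0) (hσw : σw ≠ 0)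
    (h : optimalCombining σv σw A ∈ Set.Icc (0 : ℝ) 1) :
    A * σw ^ 2 + σv ^ 2 ≠ 0 ↔ 0 ≤ A := by
  constructor
  · intro hD
    have hD_pos : 0 < A * σw ^ 2 + σv ^ 2 := by
      have hone_sub := sub_nonneg.2 h.2
      rw [one_sub_optimalCombining hD] at hone_sub
      by_contra! hD_nonpos
      exact hone_sub.not_gt (div_neg_of_pos_of_neg (by positivity) (hD_nonpos.lt_of_ne hD))
    have hA := mul_nonneg h.1 hD_pos.le
    rw [optimalCombining, div_mul_cancel₀ _ hD] at hA
    exact nonneg_of_mul_nonneg_left hA (by positivity)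
  · intro hA
    positivity

lemma optimalGain_eq_leastSquaresGain {σv σw : ℝ≥0} (hσv : σv ≠ 0) (hσw : σw ≠ 0) (σx : ℝ) {A : ℝ}
    (h : A * (σw : ℝ) ^ 2 + (σv : ℝ) ^ 2 ≠ 0) :
    optimalGain σx σv σw A = leastSquaresGain (σx ^ 2)
      (combinedNoiseVariance σv σw (optimalCombining σv σw A))
      (optimalCombining σv σw A * A + (1 - optimalCombining σv σw A)) := by
  rw [leastSquaresGain, coe_combinedNoiseVariance, one_sub_optimalCombining h, optimalCombining,
    optimalGain]
  field_simp

variable {Ω : Type*} {x v w : Ω → ℝ} {γe γd : ℝ → ℝ} {α : ℝ}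

lemma decoderInput_eq (x v w : Ω → ℝ) (γe : ℝ → ℝ) (α : ℝ) :
    decoderInput x v w γe α = fun ω ↦ combinedEncoder γe α (x ω) + combinedNoise v w α ω := by
  ext ω
  simp only [decoderInput, combinedEncoder, combinedNoise]
  ring

variable [MeasurableSpace Ω] {μ : Measure Ω} {σv σw : ℝ≥0}

lemma measurable_combinedEncoder (hγe : Measurable γe) (α : ℝ) :
    Measurable (combinedEncoder γe α) := by
  unfold combinedEncoder
  fun_prop

lemma estimationError_eq_channelError :
    estimationError μ x v w γe α γd =
      channelError μ x (combinedNoise v w α) (combinedEncoder γe α) γd := by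
  rw [estimationError, decoderInput_eq, channelError]

lemma hasLaw_combinedNoise (hv : HasLaw v (gaussianReal 0 (σv ^ 2)) μ)
    (hw : HasLaw w (gaussianReal 0 (σw ^ 2)) μ) (hvw : IndepFun v w μ) (α : ℝ) :
    HasLaw (combinedNoise v w α) (gaussianReal 0 (combinedNoiseVariance σv σw α)) μ := by
  have hlaw := hasLaw_linear_combination_gaussianReal hv hw hvw α (1 - α)
  simp only [mul_zero, add_zero] at hlaw
  exact hlaw

lemma indepFun_combinedNoise (hx : AEMeasurable x μ) (hv : AEMeasurable v μ)
    (hw : AEMeasurable w μ) (hindep : iIndepFun ![x, v, w] μ) (α : ℝ) :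
    IndepFun x (combinedNoise v w α) μ := by
  have hmeas (i : Fin 3) : AEMeasurable (![x, v, w] i) μ := by
    fin_cases i
    exacts [hx, hv, hw]
  exact ((hindep.indepFun_prodMk₀ hmeas 1 2 0 (by decide) (by decide)).comp
    (φ := fun p : ℝ × ℝ ↦ α * p.1 + (1 - α) * p.2) (by fun_prop) measurable_id).symm

lemma combinedEncoder_snr_le (hm : MemLp (fun ω ↦ γe (x ω)) 2 μ) (hx : MemLp x 2 μ)
    (hσv : σv ≠ 0) (hσw : σw ≠ 0) (α : ℝ) :
    messagePower μ x (combinedEncoder γe α) / combinedNoiseVariance σv σw α ≤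
      messagePower μ x γe / σv ^ 2 + (∫ ω, x ω ^ 2 ∂μ) / σw ^ 2 := by
  have hb := combinedNoiseVariance_ne_zero hσv hσw α
  rw [div_le_iff₀' (by positivity), coe_combinedNoiseVariance]
  exact integral_sq_linear_combination_le hm hx (by positivity) (by positivity) α (1 - α)

lemma combinedEncoder_snr_eq_iff (hm : MemLp (fun ω ↦ γe (x ω)) 2 μ) (hx : MemLp x 2 μ)
    (hσv : σv ≠ 0) (hσw : σw ≠ 0) (α : ℝ) :
    messagePower μ x (combinedEncoder γe α) / combinedNoiseVariance σv σw α =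
        messagePower μ x γe / σv ^ 2 + (∫ ω, x ω ^ 2 ∂μ) / σw ^ 2 ↔
      ∀ᵐ ω ∂μ, α * σv ^ 2 * x ω = (1 - α) * σw ^ 2 * γe (x ω) := by
  have hb := combinedNoiseVariance_ne_zero hσv hσw α
  rw [div_eq_iff (by positivity), mul_comm, coe_combinedNoiseVariance]
  exact integral_sq_linear_combination_eq_iff hm hx (by positivity) (by positivity) α (1 - α)

lemma ae_proportional_iff_exists_optimalCombining {σv σw : ℝ} {m : Ω → ℝ} (hσv : σv ≠ 0)
    (hσw : σw ≠ 0) (hx : ¬ ∀ᵐ ω ∂μ, x ω = 0) :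
    (∀ᵐ ω ∂μ, α * σv ^ 2 * x ω = (1 - α) * σw ^ 2 * m ω) ↔
      ∃ A : ℝ, A * σw ^ 2 + σv ^ 2 ≠ 0 ∧ (∀ᵐ ω ∂μ, m ω = A * x ω) ∧
        α = optimalCombining σv σw A := by
  constructor
  · intro h
    have hα : 1 - α ≠ 0 := by
      refine fun hα ↦ hx ?_
      filter_upwards [h] with ω hω
      simpa [hα, hσv, ← sub_eq_zero.1 hα] using hω
    have hD : α * σv ^ 2 / ((1 - α) * σw ^ 2) * σw ^ 2 + σv ^ 2 = σv ^ 2 / (1 - α) := by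
      field_simp
      ring
    refine ⟨α * σv ^ 2 / ((1 - α) * σw ^ 2), by rw [hD]; positivity, ?_, ?_⟩
    · filter_upwards [h] with ω hω
      field_simp
      linarith
    · rw [optimalCombining, hD]
      field_simp
  · rintro ⟨A, hD, hm, rfl⟩
    filter_upwards [hm] with ω hω
    rw [one_sub_optimalCombining hD, optimalCombining, hω]
    ring

lemma eq_ofReal_div_add_one_iff {a q t : ℝ} {E : ℝ≥0∞} (ha : 0 < a) (hq : 0 ≤ q) (hqt : q ≤ t)
    (hE : ENNReal.ofReal (a / (q + 1)) ≤ E) :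
    E = ENNReal.ofReal (a / (t + 1)) ↔ q = t ∧ E = ENNReal.ofReal (a / (q + 1)) := by
  refine ⟨fun h ↦ ?_, fun ⟨hqt, h⟩ ↦ hqt ▸ h⟩
  have ht : 0 ≤ t := hq.trans hqt
  rw [h, ENNReal.ofReal_le_ofReal_iff (by positivity),
    div_le_div_iff_of_pos_left ha (by positivity) (by positivity)] at hE
  obtain rfl : q = t := by linarith
  exact ⟨rfl, h⟩

lemma le_estimationError {σx : ℝ≥0} (hσx : σx ≠ 0) (hσv : σv ≠ 0) (hσw : σw ≠ 0)
    (hx : HasLaw x (gaussianReal 0 (σx ^ 2)) μ) (hv : HasLaw v (gaussianReal 0 (σv ^ 2)) μ)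
    (hw : HasLaw w (gaussianReal 0 (σw ^ 2)) μ) (hindep : iIndepFun ![x, v, w] μ)
    (hγe : Measurable γe) (hm : MemLp (fun ω ↦ γe (x ω)) 2 μ) (hγd : Measurable γd) :
    ENNReal.ofReal
        (σx ^ 2 / (messagePower μ x (combinedEncoder γe α) / combinedNoiseVariance σv σw α + 1)) ≤
      estimationError μ x v w γe α γd := by
  have hfx : MemLp (fun ω ↦ combinedEncoder γe α (x ω)) 2 μ :=
    (hm.const_mul α).add (hx.hasGaussianLaw.memLp_two.const_mul (1 - α))
  rw [estimationError_eq_channelError, ← NNReal.coe_pow]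
  exact le_channelError (pow_ne_zero 2 hσx) (combinedNoiseVariance_ne_zero hσv hσw α) hx
    (hasLaw_combinedNoise hv hw (hindep.indepFun (i := 1) (j := 2) (by decide)) α)
    (indepFun_combinedNoise hx.aemeasurable hv.aemeasurable hw.aemeasurable hindep α)
    (measurable_combinedEncoder hγe α) hγd hfx

lemma estimationError_eq_iff_of_matched_encoder {σx : ℝ≥0} (hσv : σv ≠ 0) (hσw : σw ≠ 0)
    (hx : HasLaw x (gaussianReal 0 (σx ^ 2)) μ) (hv : HasLaw v (gaussianReal 0 (σv ^ 2)) μ)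
    (hw : HasLaw w (gaussianReal 0 (σw ^ 2)) μ) (hindep : iIndepFun ![x, v, w] μ)
    (hγd : Measurable γd) {A : ℝ} (hA : A * (σw : ℝ) ^ 2 + (σv : ℝ) ^ 2 ≠ 0)
    (hm : ∀ᵐ ω ∂μ, γe (x ω) = A * x ω) (hα : α = optimalCombining σv σw A) :
    estimationError μ x v w γe α γd = ENNReal.ofReal
        (σx ^ 2 / (messagePower μ x (combinedEncoder γe α) / combinedNoiseVariance σv σw α + 1)) ↔
      ∀ᵐ ω ∂μ, γd (decoderInput x v w γe α ω) =
        optimalGain σx σv σw A * decoderInput x v w γe α ω := by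
  have hlinear : ∀ᵐ ω ∂μ, combinedEncoder γe α (x ω) = (α * A + (1 - α)) * x ω := by
    filter_upwards [hm] with ω hω
    rw [combinedEncoder, hω]
    ring
  have hiff := channelError_eq_iff_of_ae_linear (combinedNoiseVariance_ne_zero hσv hσw α) hx
    (hasLaw_combinedNoise hv hw (hindep.indepFun (i := 1) (j := 2) (by decide)) α)
    (indepFun_combinedNoise hx.aemeasurable hv.aemeasurable hw.aemeasurable hindep α) hγd hlinear
  rw [NNReal.coe_pow] at hiff
  rw [estimationError_eq_channelError, hiff, optimalGain_eq_leastSquaresGain hσv hσw _ hA, ← hα,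
    decoderInput_eq]

end Combining

theorem mainTheorem4_general {Ω : Type*} [MeasurableSpace Ω] (μ : Measure Ω)
    (σx σv σw : ℝ≥0) (hσx : 0 < σx) (hσv : 0 < σv) (hσw : 0 < σw)
    (x v w : Ω → ℝ)
    (hx : HasLaw x (gaussianReal 0 (σx ^ 2)) μ)
    (hv : HasLaw v (gaussianReal 0 (σv ^ 2)) μ)
    (hw : HasLaw w (gaussianReal 0 (σw ^ 2)) μ)
    (hindep : iIndepFun ![x, v, w] μ)
    (γe : ℝ → ℝ) (hγe : Measurable γe) (hpow : Integrable (fun ω => (γe (x ω)) ^ 2) μ)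
    (P : ℝ) (hP : P = messagePower μ x γe)
    (α : ℝ) (γd : ℝ → ℝ) (hγd : Measurable γd) :
    ENNReal.ofReal ((σx : ℝ) ^ 2 / (P / (σv : ℝ) ^ 2 + (σx : ℝ) ^ 2 / (σw : ℝ) ^ 2 + 1))
        ≤ estimationError μ x v w γe α γd ∧
      (estimationError μ x v w γe α γd =
          ENNReal.ofReal ((σx : ℝ) ^ 2 / (P / (σv : ℝ) ^ 2 + (σx : ℝ) ^ 2 / (σw : ℝ) ^ 2 + 1)) ↔
        ∃ A : ℝ, A * (σw : ℝ) ^ 2 + (σv : ℝ) ^ 2 ≠ 0 ∧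
          (∀ᵐ ω ∂μ, γe (x ω) = A * x ω) ∧
          α = optimalCombining σv σw A ∧
          (∀ᵐ ω ∂μ, γd (decoderInput x v w γe α ω) =
            optimalGain σx σv σw A * decoderInput x v w γe α ω)) := by
  have hx2 : ∫ ω, x ω ^ 2 ∂μ = (σx : ℝ) ^ 2 := by
    simpa using integral_sq_of_hasLaw_gaussianReal hx
  have hxL := hx.hasGaussianLaw.memLp_two
  have hmL : MemLp (fun ω ↦ γe (x ω)) 2 μ := (memLp_two_iff_integrable_sq
    (hγe.comp_aemeasurable hx.aemeasurable).aestronglyMeasurable).2 hpow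
  have hsnr_nonneg : 0 ≤ messagePower μ x (combinedEncoder γe α) / combinedNoiseVariance σv σw α :=
    div_nonneg messagePower_nonneg (NNReal.coe_nonneg _)
  have hsnr_le := combinedEncoder_snr_le hmL hxL hσv.ne' hσw.ne' α
  have hsnr_eq := combinedEncoder_snr_eq_iff hmL hxL hσv.ne' hσw.ne' α
  have herr := le_estimationError (α := α) hσx.ne' hσv.ne' hσw.ne' hx hv hw hindep hγe hmL hγd
  rw [← hP, hx2] at hsnr_le hsnr_eq
  refine ⟨(ENNReal.ofReal_le_ofReal (by gcongr)).trans herr, ?_⟩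
  rw [eq_ofReal_div_add_one_iff (by positivity) hsnr_nonneg hsnr_le herr, hsnr_eq,
    ae_proportional_iff_exists_optimalCombining (by positivity) (by positivity)
      (not_ae_eq_zero_of_hasLaw_gaussianReal (by positivity) hx), ← exists_and_right]
  refine exists_congr fun A ↦ ?_
  simp only [and_assoc]
  exact and_congr_right fun hA ↦ and_congr_right fun hm ↦ and_congr_right fun hα ↦
    estimationError_eq_iff_of_matched_encoder hσv.ne' hσw.ne' hx hv hw hindep hγd hA hm hα

theorem mainTheorem4 {Ω : Type*} [MeasurableSpace Ω] (μ : Measure Ω) [IsProbabilityMeasure μ]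
    (σx σv σw : ℝ≥0) (hσx : 0 < σx) (hσv : 0 < σv) (hσw : 0 < σw)
    (x v w : Ω → ℝ)
    (hx : HasLaw x (gaussianReal 0 (σx ^ 2)) μ)
    (hv : HasLaw v (gaussianReal 0 (σv ^ 2)) μ)
    (hw : HasLaw w (gaussianReal 0 (σw ^ 2)) μ)
    (hindep : iIndepFun ![x, v, w] μ)
    (γe : ℝ → ℝ) (hγe : Measurable γe) (hpow : Integrable (fun ω => (γe (x ω)) ^ 2) μ)
    (P : ℝ) (hP : P = messagePower μ x γe)
    (α : ℝ) (hα : α ∈ Set.Icc (0 : ℝ) 1)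
    (γd : ℝ → ℝ) (hγd : Measurable γd) :
    ENNReal.ofReal ((σx : ℝ) ^ 2 / (P / (σv : ℝ) ^ 2 + (σx : ℝ) ^ 2 / (σw : ℝ) ^ 2 + 1))
        ≤ estimationError μ x v w γe α γd ∧
      (estimationError μ x v w γe α γd =
          ENNReal.ofReal ((σx : ℝ) ^ 2 / (P / (σv : ℝ) ^ 2 + (σx : ℝ) ^ 2 / (σw : ℝ) ^ 2 + 1)) ↔
        ∃ A : ℝ, 0 ≤ A ∧
          (∀ᵐ ω ∂μ, γe (x ω) = A * x ω) ∧
          α = optimalCombining σv σw A ∧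
          (∀ᵐ ω ∂μ, γd (decoderInput x v w γe α ω) =
            optimalGain σx σv σw A * decoderInput x v w γe α ω)) := by
  obtain ⟨hle, heq⟩ := mainTheorem4_general μ σx σv σw hσx hσv hσw x v w hx hv hw hindep γe hγe hpow
    P hP α γd hγd
  exact ⟨hle, heq.trans <| exists_congr fun A ↦ and_congr_left fun h ↦
    nonneg_iff_of_optimalCombining_mem_Icc (by positivity) (by positivity) (h.2.1 ▸ hα)⟩
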